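/- For complex $z=x+iy$ and $t=u+iv$ let $\phi(t)=\tfrac13t^3-zt=\phi_r(u,v)+i\phi_i(u,v)$, so that $\phi_r(u,v)=\tfrac13u^3-uv^2-xu+yv$ and $\phi_i(u,v)=u^2v-\tfrac13v^3-xv-yu$. Let $\mathrm{Hi}(z)=\frac1\pi\int_0^\infty e^{zt-t^3/3}\,dt$ be the Scorer function, and $\mathrm{Ai}(z)=\frac1{2\pi i}\int_{\infty e^{-\pi i/3}}^{\infty e^{\pi i/3}}e^{-zt+t^3/3}\,dt$ the Airy function. Let $0\le\mathrm{ph}\,z\le\frac23\pi$ or $z=0$. Put $$R(v)=\sqrt{y^2+4v^2\left(x+\tfrac13v^2\right)}\ge0,\qquad u(v)=\frac{y-R(v)}{2v},\qquad h(v)=\frac{v^2-u(v)^2+x}{2u(v)v-y}+i\qquad(v>0).$$ Then: 1. The quantity under the square root is non-negative for all real $v$. The curve $t(v)=u(v)+iv$, $v>0$, is continuous, $\phi_i$ vanishes on it, and $h(v)=dt/dv$ for all $v>0$, except at the corner $v=\sqrt{-3x/2}$ of the curve when $\mathrm{ph}\,z=\frac23\pi$. As $v\to\infty$, $|t(v)|\to\infty$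 and $t(v)/|t(v)|\to e^{2\pi i/3}$. As $v\to0^+$, $t(v)\to0$ if $y>0$, and $t(v)\to-\sqrt x$ if $y=0$ (in which case $x\ge0$). 2. Let $\mathcal L$ be this curve if $y>0$, and the segment from $0$ to $-\sqrt x$ followed by this curve if $y=0$; it is a path from the origin to $\infty e^{2\pi i/3}$. The function $e^{-\phi_r(u(v),v)}h(v)$ is absolutely integrable over $(0,\infty)$, and $$\mathrm{Hi}(z)=\frac1\pi\int_{\mathcal L}e^{-\phi_r(u,v)}\,dt+2e^{-\pi i/6}\,\mathrm{Ai}\!\left(ze^{-2\pi i/3}\right),$$ where $$\int_{\mathcal L}e^{-\phi_r(u,v)}\,dt=\int_0^\infty e^{-\phi_r(u(v),v)}h(v)\,dv\quad(y>0),$$ $$\int_{\mathcal L}e^{-\phi_r(u,v)}\,dt=\int_0^{-\sqrt x}e^{-\phi_r(u,0)}\,du+\int_0^\infty e^{-\phi_r(u(v),v)}h(v)\,dv\quad(y=0).$$ 3. The two terms are, respectively, $$\frac1\pi\int_{\mathcal L}e^{-\phi_r(u,v)}\,dt=e^{2\pi i/3}\,\mathrm{Hi}\!\left(ze^{2\pi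 i/3}\right),\qquad 2e^{-\pi i/6}\,\mathrm{Ai}\!\left(ze^{-2\pi i/3}\right)=\frac1\pi\int_{\infty e^{2\pi i/3}}^{+\infty}e^{-\phi(t)}\,dt.$$ -/

import Mathlib

open Real Set Filter Topology MeasureTheory

noncomputable section

/-- The integral of `f` along the ray from the origin to `∞ e^{iθ}`. -/
def rayIntegral (f : ℂ → ℂ) (θ : ℝ) : ℂ :=
  ∫ s in Ioi (0 : ℝ), f ((s : ℂ) * Complex.exp (θ * Complex.I)) * Complex.exp (θ * Complex.I)

/-- The Airy function `Ai(z) = (1/2πi) ∫ e^{-zt + t³/3} dt`, the contour running from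
`∞ e^{-πi/3}` to `∞ e^{πi/3}` (here through the origin, along two rays). -/
def airyAi (z : ℂ) : ℂ :=
  1 / (2 * π * Complex.I) *
    (rayIntegral (fun t => Complex.exp (-z * t + t ^ 3 / 3)) (π / 3)
      - rayIntegral (fun t => Complex.exp (-z * t + t ^ 3 / 3)) (-(π / 3)))

/-- The Scorer function `Hi(z) = (1/π) ∫_0^∞ e^{zt - t³/3} dt`. -/
def scorerHi (z : ℂ) : ℂ :=
  1 / π * ∫ t in Ioi (0 : ℝ), Complex.exp (z * t - (t : ℂ) ^ 3 / 3)

/-- The phase function `φ(t) = t³/3 - zt`. -/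
def phi (z t : ℂ) : ℂ := t ^ 3 / 3 - z * t

/-- The real part `φ_r(u,v)` of `φ(u + iv)`, with `z = x + iy`. -/
def phiRe (z : ℂ) (u v : ℝ) : ℝ := u ^ 3 / 3 - u * v ^ 2 - z.re * u + z.im * v

/-- The imaginary part `φ_i(u,v)` of `φ(u + iv)`, with `z = x + iy`. -/
def phiIm (z : ℂ) (u v : ℝ) : ℝ := u ^ 2 * v - v ^ 3 / 3 - z.re * v - z.im * u

theorem phi_eq (z : ℂ) (u v : ℝ) :
    phi z (u + v * Complex.I) = phiRe z u v + phiIm z u v * Complex.I := by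
  apply Complex.ext <;> simp [phi, phiRe, phiIm, pow_succ] <;> ring

/-- The quantity under the square root that defines `R`. -/
def radicand (z : ℂ) (v : ℝ) : ℝ := z.im ^ 2 + 4 * v ^ 2 * (z.re + v ^ 2 / 3)

/-- `R = √(y² + 4v²(x + v²/3))`. -/
def bigR (z : ℂ) (v : ℝ) : ℝ := √(radicand z v)

/-- The path `𝓛`, as `u` in terms of `v`: `u = (y - R) / (2v)`. -/
def pathU (z : ℂ) (v : ℝ) : ℝ := (z.im - bigR z v) / (2 * v)

/-- The point `t = u + iv` of the path `𝓛`. -/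
def pathT (z : ℂ) (v : ℝ) : ℂ := pathU z v + v * Complex.I

/-- `h(v) = (v² - u² + x) / (2uv - y) + i`, with `u` on the path `𝓛`. -/
def pathH (z : ℂ) (v : ℝ) : ℂ :=
  (((v ^ 2 - pathU z v ^ 2 + z.re) / (2 * pathU z v * v - z.im) : ℝ) : ℂ) + Complex.I

/-- The integrand `e^{-φ_r(u,v)} h(v)` along the path `𝓛`. -/
def pathIntegrand (z : ℂ) (v : ℝ) : ℂ :=
  (rexp (-phiRe z (pathU z v) v) : ℂ) * pathH z v

end

/-! The function `e^{-φ}` is entire, so it has a primitive `F`, and no contour has to be deformed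
explicitly. On the curve `φ_i = 0`, so `e^{-φ_r} h` is the derivative of `F(t(v))` and its integral
is the difference of the limits of `F` at the two ends (`integral_pathIntegrand`). At height `v` the
curve and the ray `ph t = 2π/3` are joined by a horizontal segment of length at most `v` on which
`φ_r ≥ v`; hence `F` has the same limit along both (`tendsto_primitive_pathT_sub`). On the ray, `ω =
e^{2πi/3}` has `ω³ = 1`, and the integral is `π ω Hi(zω)`.

The same rotation writes `Ai` as a difference of two values of `Hi` (`two_mul_airyAi_eq`), which
supplies the remaining term.

Absolute integrability follows from a bounded slope (`abs_slope_le`) and linear growth of `φ_r`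
(`exists_linear_le_phiRe`). The sector enters as `√3 x + y ≥ 0`, `y ≥ 0`: for `x < 0` this gives
`3x² ≤ y²`, exactly what keeps the radicand nonnegative. -/

/-! ### The sector and the sign of the radicand -/

/-- The sector `0 ≤ ph z ≤ 2π/3` in terms of real and imaginary parts. -/
theorem im_nonneg_and_sector {z : ℂ} (h₀ : 0 ≤ z.arg) (h₁ : z.arg ≤ 2 * π / 3) :
    0 ≤ z.im ∧ 0 ≤ √3 * z.re + z.im := by
  refine ⟨Complex.arg_nonneg_iff.1 h₀, ?_⟩
  have hs : 0 ≤ sin (z.arg + π / 3) :=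
    sin_nonneg_of_nonneg_of_le_pi (by positivity) (by linarith)
  rw [sin_add, sin_pi_div_three, cos_pi_div_three] at hs
  have hre := Complex.norm_mul_cos_arg z
  have him := Complex.norm_mul_sin_arg z
  have := mul_nonneg (norm_nonneg z) hs
  rw [← hre, ← him]
  nlinarith

/-- Completing the square in `v²` isolates the constant `y² - 3x²`, whose sign is controlled by the
sector when `x < 0`. -/
theorem radicand_eq (z : ℂ) (v : ℝ) :
    radicand z v = 4 / 3 * (v ^ 2 + 3 * z.re / 2) ^ 2 + (z.im ^ 2 - 3 * z.re ^ 2) := by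
  unfold radicand; ring

theorem three_mul_sq_re_le {z : ℂ} (hs : 0 ≤ √3 * z.re + z.im) (hx : z.re < 0) :
    3 * z.re ^ 2 ≤ z.im ^ 2 := by
  have h3 : √3 ^ 2 = 3 := sq_sqrt (by norm_num)
  have h3' : 0 < √3 := by positivity
  nlinarith [mul_pos_of_neg_of_neg hx hx, mul_pos h3' (neg_pos.2 hx)]

theorem radicand_nonneg {z : ℂ} (hs : 0 ≤ √3 * z.re + z.im) (v : ℝ) : 0 ≤ radicand z v := by
  rcases le_or_gt 0 z.re with hx | hx
  · unfold radicand; positivity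
  · have := three_mul_sq_re_le hs hx
    rw [radicand_eq]
    nlinarith [sq_nonneg (v ^ 2 + 3 * z.re / 2)]

theorem bigR_nonneg (z : ℂ) (v : ℝ) : 0 ≤ bigR z v := sqrt_nonneg _

theorem bigR_sq {z : ℂ} (hs : 0 ≤ √3 * z.re + z.im) (v : ℝ) : bigR z v ^ 2 = radicand z v :=
  sq_sqrt (radicand_nonneg hs v)

/-- The radicand vanishes only at the corner `v = √(-3x/2)` for `ph z = 2π/3`. -/
theorem radicand_pos {z : ℂ} (hy : 0 ≤ z.im) (hs : 0 ≤ √3 * z.re + z.im) {v : ℝ} (hv : 0 < v)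
    (hc : z.arg = 2 * π / 3 → v ≠ √(-(3 * z.re / 2))) : 0 < radicand z v := by
  refine (radicand_nonneg hs v).lt_of_ne' fun h0 => ?_
  have hx : z.re < 0 := by
    by_contra! hx
    have : 0 < radicand z v := by unfold radicand; positivity
    exact this.ne' h0
  have hxy := three_mul_sq_re_le hs hx
  rw [radicand_eq] at h0
  have h1 : (v ^ 2 + 3 * z.re / 2) ^ 2 = 0 := by nlinarith [sq_nonneg (v ^ 2 + 3 * z.re / 2)]
  have h2 : z.im ^ 2 = 3 * z.re ^ 2 := by nlinarith [sq_nonneg (v ^ 2 + 3 * z.re / 2)]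
  have h3 : √3 ^ 2 = 3 := sq_sqrt (by norm_num)
  have h3' : 0 < √3 := by positivity
  have h4 : z.im = √3 * -z.re := by
    refine (sq_eq_sq₀ hy (mul_nonneg h3'.le (by linarith))).1 ?_
    rw [h2, mul_pow, h3]; ring
  have harg : z.arg = 2 * π / 3 := by
    have hz : z = ((-2 * z.re : ℝ) : ℂ) *
        (Complex.cos ((2 * π / 3 : ℝ) : ℂ) + Complex.sin ((2 * π / 3 : ℝ) : ℂ) * Complex.I) := by
      have e : 2 * π / 3 = π - π / 3 := by ring
      rw [← Complex.ofReal_cos, ← Complex.ofReal_sin, e, cos_pi_sub, sin_pi_sub,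
        cos_pi_div_three, sin_pi_div_three]
      apply Complex.ext
      · simp; ring
      · simp only [Complex.add_im, Complex.ofReal_im, Complex.mul_im,
          Complex.I_im, Complex.I_re, Complex.ofReal_re]
        rw [h4]; ring
    rw [hz, Complex.arg_mul_cos_add_sin_mul_I (by linarith)]
    constructor <;> linarith [pi_pos]
  refine hc harg ?_
  rw [pow_eq_zero_iff two_ne_zero] at h1
  rw [eq_comm, sqrt_eq_iff_mul_self_eq (by linarith) hv.le]
  linarith

/-! ### The equation and the derivative of the curve -/

theorem two_mul_pathU (z : ℂ) {v : ℝ} (hv : v ≠ 0) : 2 * pathU z v * v = z.im - bigR z v := by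
  unfold pathU; field_simp

/-- The quadratic equation for `u` on the path. -/
theorem pathU_quadratic {z : ℂ} (hs : 0 ≤ √3 * z.re + z.im) {v : ℝ} (hv : v ≠ 0) :
    v * pathU z v ^ 2 - z.im * pathU z v = v ^ 3 / 3 + z.re * v := by
  have h := bigR_sq hs v
  have hR : bigR z v = z.im - 2 * pathU z v * v := by linarith [two_mul_pathU z hv]
  rw [hR] at h
  unfold radicand at h
  apply mul_left_cancel₀ hv
  linear_combination h / 4

theorem phiIm_pathU {z : ℂ} (hs : 0 ≤ √3 * z.re + z.im) {v : ℝ} (hv : v ≠ 0) :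
    phiIm z (pathU z v) v = 0 := by
  unfold phiIm
  linear_combination pathU_quadratic hs hv

theorem continuous_bigR (z : ℂ) : Continuous (bigR z) := by
  unfold bigR radicand; fun_prop

theorem continuousOn_pathU (z : ℂ) : ContinuousOn (pathU z) (Ioi 0) := by
  unfold pathU
  have := continuous_bigR z
  refine ContinuousOn.div (by fun_prop) (by fun_prop) fun v hv => ?_
  have : (0 : ℝ) < v := hv
  positivity

theorem continuousOn_pathT (z : ℂ) : ContinuousOn (pathT z) (Ioi 0) := by
  have := continuousOn_pathU z
  unfold pathT
  fun_prop

theorem hasDerivAt_pathU {z : ℂ} (hs : 0 ≤ √3 * z.re + z.im) {v : ℝ} (hv : 0 < v)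
    (hR : 0 < radicand z v) :
    HasDerivAt (pathU z)
      ((v ^ 2 - pathU z v ^ 2 + z.re) / (2 * pathU z v * v - z.im)) v := by
  have hr : HasDerivAt (radicand z) (8 * v * (z.re + v ^ 2 / 3) + 4 * v ^ 2 * (2 * v / 3)) v := by
    unfold radicand
    refine ((((hasDerivAt_id v).pow 2).const_mul 4 |>.mul
      ((((hasDerivAt_id v).pow 2).div_const 3).const_add z.re)).const_add (z.im ^ 2)).congr_deriv ?_
    simp only [Pi.pow_apply, id, Nat.cast_ofNat, Nat.add_one_sub_one, pow_one]
    ring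
  have hB := hr.sqrt hR.ne'
  have hRp : 0 < bigR z v := sqrt_pos.2 hR
  have hU := (hB.const_sub z.im).div ((hasDerivAt_id v).const_mul 2) (by simp [hv.ne'])
  refine hU.congr_deriv ?_
  have h2 := two_mul_pathU z hv.ne'
  have hsq := bigR_sq hs v
  have e1 : 2 * pathU z v * v - z.im = -bigR z v := by linarith
  rw [e1]
  change ((-((8 * v * (z.re + v ^ 2 / 3) + 4 * v ^ 2 * (2 * v / 3)) / (2 * bigR z v)) * (2 * v)
    - (z.im - bigR z v) * (2 * 1)) / (2 * v) ^ 2) = _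
  rw [show pathU z v = (z.im - bigR z v) / (2 * v) from rfl]
  unfold radicand at hsq
  field_simp
  linear_combination 3 * hsq

theorem hasDerivAt_pathT {z : ℂ} (hs : 0 ≤ √3 * z.re + z.im) {v : ℝ} (hv : 0 < v)
    (hR : 0 < radicand z v) : HasDerivAt (pathT z) (pathH z v) v := by
  have h1 := (hasDerivAt_pathU hs hv hR).ofReal_comp
  have h2 := ((hasDerivAt_id v).ofReal_comp).mul_const Complex.I
  exact (h1.add h2).congr_deriv (by simp [pathH])

/-! ### Bounds along the curve and absolute integrability -/

/-- The slope of the path is bounded. -/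
theorem abs_slope_le {z : ℂ} (hy : 0 ≤ z.im) (hs : 0 ≤ √3 * z.re + z.im) {v : ℝ} (hv : 0 < v) :
    |(v ^ 2 - pathU z v ^ 2 + z.re) / (2 * pathU z v * v - z.im)| ≤ 3 + 2 * (|z.re| / z.im) := by
  have h2 := two_mul_pathU z hv.ne'
  have hsq := bigR_sq hs v
  have e1 : 2 * pathU z v * v - z.im = -bigR z v := by linarith
  rw [e1, div_neg, abs_neg]
  -- At the corner `R = 0` and the quotient is `0` by convention. Likewise `|x| / y` is `0` when `y
  -- = 0`.
  rcases (bigR_nonneg z v).eq_or_lt with h0 | hR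
  · rw [← h0]; simp; positivity
  have hRy : 0 < bigR z v + z.im := by linarith
  -- Since `R² - y²` is divisible by `v²`, multiplying by `R + y` clears the powers of `v` in the
  -- denominator. The two resulting terms contribute at most `2/3` and `2(1 + |x|/y)`.
  have hN : v ^ 2 - pathU z v ^ 2 + z.re =
      (2 / 3 * v ^ 2 * bigR z v + 2 * z.im * (z.re + 2 * v ^ 2 / 3)) / (bigR z v + z.im) := by
    rw [show pathU z v = (z.im - bigR z v) / (2 * v) from rfl]
    unfold radicand at hsq
    field_simp
    linear_combination (-3 * (bigR z v - z.im)) * hsq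
  have h3 : √3 ^ 2 = 3 := sq_sqrt (by norm_num)
  have h3' : 0 < √3 := by positivity
  have h31 : 1 ≤ √3 := by nlinarith
  set R := bigR z v with hRdef
  have hrad := radicand_eq z v
  have hv2 : v ^ 2 ≤ R + z.im := by
    rcases le_or_gt 0 z.re with hx | hx
    · have : v ^ 2 ≤ R := by
        apply le_of_sq_le_sq _ hR.le
        rw [hsq]; unfold radicand
        nlinarith [sq_nonneg z.im, mul_nonneg (sq_nonneg v) hx, sq_nonneg (v ^ 2)]
      linarith
    · have hxy := three_mul_sq_re_le hs hx
      have h1 : |v ^ 2 + 3 * z.re / 2| * 2 ≤ √3 * R := by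
        apply le_of_sq_le_sq _ (by positivity)
        rw [mul_pow, sq_abs, mul_pow, h3, hsq, hrad]
        nlinarith
      have := le_abs_self (v ^ 2 + 3 * z.re / 2)
      have h5 : v ^ 2 * 2 ≤ √3 * (R + z.im) := by nlinarith
      nlinarith [show √3 ≤ 2 by nlinarith]
  have hB : z.im * |z.re + 2 * v ^ 2 / 3| ≤ (1 + |z.re| / z.im) * (R * (R + z.im)) := by
    rcases hy.eq_or_lt with h0 | hy'
    · rw [← h0]; simp; positivity
    rcases le_or_gt 0 z.re with hx | hx
    · have hyR : z.im ≤ R := by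
        apply le_of_sq_le_sq _ hR.le
        rw [hsq]; unfold radicand
        have : 0 ≤ 4 * v ^ 2 * (z.re + v ^ 2 / 3) := by positivity
        linarith
      have hvR : v ^ 2 ≤ R := by
        apply le_of_sq_le_sq _ hR.le
        rw [hsq]; unfold radicand
        nlinarith [sq_nonneg z.im, mul_nonneg (sq_nonneg v) hx, sq_nonneg (v ^ 2)]
      rw [abs_of_nonneg (by positivity), abs_of_nonneg hx]
      have hxR : z.re ≤ z.re / z.im * R := by
        rw [div_mul_eq_mul_div, le_div_iff₀ hy']; gcongr
      have h6 : z.re + 2 * v ^ 2 / 3 ≤ (1 + z.re / z.im) * R := by linarith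
      calc z.im * (z.re + 2 * v ^ 2 / 3) ≤ (R + z.im) * ((1 + z.re / z.im) * R) := by
            gcongr; linarith
        _ = _ := by ring
    · have hxy := three_mul_sq_re_le hs hx
      have h1 : |z.re + 2 * v ^ 2 / 3| ≤ R := by
        apply abs_le_of_sq_le_sq _ hR.le
        rw [hsq, hrad]
        nlinarith [sq_nonneg (v ^ 2 + 3 * z.re / 2)]
      calc z.im * |z.re + 2 * v ^ 2 / 3| ≤ (R + z.im) * R := by gcongr; linarith
        _ = 1 * (R * (R + z.im)) := by ring
        _ ≤ _ := by gcongr; linarith [show 0 ≤ |z.re| / z.im by positivity]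
  rw [hN, div_div, abs_div, abs_of_pos (show 0 < (R + z.im) * R by positivity),
    div_le_iff₀ (by positivity)]
  have h7 := abs_add_le (2 / 3 * v ^ 2 * R) (2 * z.im * (z.re + 2 * v ^ 2 / 3))
  rw [abs_of_nonneg (show 0 ≤ 2 / 3 * v ^ 2 * R by positivity), abs_mul,
    abs_of_nonneg (show 0 ≤ 2 * z.im by positivity)] at h7
  have : v ^ 2 * R ≤ (R + z.im) * R := by gcongr
  have : 0 ≤ |z.re| / z.im * ((R + z.im) * R) := by positivity
  nlinarith

theorem pathU_nonpos {z : ℂ} {v : ℝ} (hv : 0 < v) (h : 0 ≤ z.re + v ^ 2 / 3) :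
    pathU z v ≤ 0 := by
  have : z.im ≤ bigR z v := by
    apply le_sqrt_of_sq_le
    unfold radicand
    have : 0 ≤ 4 * v ^ 2 * (z.re + v ^ 2 / 3) := by positivity
    linarith
  exact div_nonpos_of_nonpos_of_nonneg (by linarith) (by positivity)

theorem pathU_nonneg {z : ℂ} (hy : 0 ≤ z.im) {v : ℝ} (hv : 0 < v) (h : z.re + v ^ 2 / 3 ≤ 0) :
    0 ≤ pathU z v := by
  have : bigR z v ≤ z.im := by
    rw [bigR, sqrt_le_left hy]
    unfold radicand
    have : 4 * v ^ 2 * (z.re + v ^ 2 / 3) ≤ 0 := mul_nonpos_of_nonneg_of_nonpos (by positivity) h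
    linarith
  exact div_nonneg (by linarith) (by positivity)

/-- The quadratic equation eliminates `u³`, leaving terms of readable sign: all are nonnegative when
`u ≤ 0` and `v² ≥ -3x`. -/
theorem mul_phiRe_pathU {z : ℂ} (hs : 0 ≤ √3 * z.re + z.im) {v : ℝ} (hv : v ≠ 0) :
    v * phiRe z (pathU z v) v = z.im * (pathU z v ^ 2 / 3 + v ^ 2)
      - pathU z v * v * (8 / 9 * v ^ 2 + 2 / 3 * z.re) := by
  unfold phiRe
  linear_combination (pathU z v / 3) * pathU_quadratic hs hv

/-- `φ_r` grows at least linearly along the path. -/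
theorem exists_linear_le_phiRe {z : ℂ} (hy : 0 ≤ z.im) (hs : 0 ≤ √3 * z.re + z.im) :
    ∃ b C : ℝ, 0 < b ∧ ∀ v : ℝ, 0 < v → b * v - C ≤ phiRe z (pathU z v) v := by
  have h3 : √3 ^ 2 = 3 := sq_sqrt (by norm_num)
  have h3' : 0 < √3 := by positivity
  rcases hy.eq_or_lt with h0 | hy'
  · refine ⟨1, 1, one_pos, fun v hv => ?_⟩
    have hx : 0 ≤ z.re := by
      rw [← h0] at hs
      exact nonneg_of_mul_nonneg_right (by linarith) h3'
    have hu := pathU_nonpos (z := z) hv (by positivity)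
    have hq := pathU_quadratic hs hv.ne'
    have hm := mul_phiRe_pathU hs hv.ne'
    rw [← h0] at hq hm
    set u := pathU z v
    have hq' : u ^ 2 = v ^ 2 / 3 + z.re := by
      apply mul_left_cancel₀ hv.ne'; linear_combination hq
    have hm' : phiRe z u v = -u * (8 / 9 * v ^ 2 + 2 / 3 * z.re) := by
      apply mul_left_cancel₀ hv.ne'; linear_combination hm
    have huv : v / 2 ≤ -u := by
      apply le_of_sq_le_sq _ (by linarith)
      nlinarith [sq_nonneg v]
    have : v / 2 * (8 / 9 * v ^ 2 + 0) ≤ -u * (8 / 9 * v ^ 2 + 2 / 3 * z.re) := by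
      gcongr
      · linarith
      · positivity
    rw [hm']
    nlinarith [mul_nonneg hv.le (sq_nonneg (v - 1)), sq_nonneg (v - 1)]
  -- For `x < 0` the curve meets the imaginary axis at `v = √(-3x)`. Above that height `φ_r ≥ yv`;
  -- below it `φ_r ≥ 0`, and the constant absorbs `yv`.
  · refine ⟨z.im, z.im * √(3 * |z.re|), hy', fun v hv => ?_⟩
    have hm := mul_phiRe_pathU hs hv.ne'
    rcases le_or_gt 0 (z.re + v ^ 2 / 3) with hx | hx
    · have hu := pathU_nonpos (z := z) hv hx
      have h1 : 0 ≤ -pathU z v * v * (8 / 9 * v ^ 2 + 2 / 3 * z.re) := by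
        apply mul_nonneg (mul_nonneg (by linarith) hv.le)
        nlinarith [sq_nonneg v]
      have h2 : z.im * v ≤ phiRe z (pathU z v) v := by
        apply le_of_mul_le_mul_left _ hv
        rw [hm]
        nlinarith [mul_nonneg hy (sq_nonneg (pathU z v))]
      have : 0 ≤ z.im * √(3 * |z.re|) := by positivity
      linarith
    · have hu := pathU_nonneg hy hv hx.le
      have hre : z.re < 0 := by nlinarith [sq_nonneg v]
      have hvx : v ≤ √(3 * |z.re|) := by
        apply le_sqrt_of_sq_le
        rw [abs_of_neg hre]; linarith
      have h4 : z.im * v ≤ z.im * √(3 * |z.re|) := by gcongr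
      have h5 : 0 ≤ phiRe z (pathU z v) v := by
        apply nonneg_of_mul_nonneg_right _ hv
        rw [hm]
        -- Here `v² < -3x`, so the last factor is at most `-2x ≤ (2/√3) y`; the AM-GM bound `h7`
        -- then matches this constant exactly.
        have h6 : pathU z v * v * (8 / 9 * v ^ 2 + 2 / 3 * z.re) ≤
            pathU z v * v * (2 / 3 * √3 * z.im) := by
          gcongr
          nlinarith
        have h7 : 2 / 3 * √3 * (pathU z v * v) ≤ pathU z v ^ 2 / 3 + v ^ 2 := by
          nlinarith [sq_nonneg (√3 * pathU z v - 3 * v)]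
        nlinarith
      linarith

theorem measurable_pathIntegrand (z : ℂ) : Measurable (pathIntegrand z) := by
  have hR := (continuous_bigR z).measurable
  have hU : Measurable (pathU z) := by unfold pathU; fun_prop
  have hH : Measurable (pathH z) := by
    unfold pathH
    refine (Complex.measurable_ofReal.comp ?_).add_const _
    fun_prop
  unfold pathIntegrand phiRe
  refine (Complex.measurable_ofReal.comp ?_).mul hH
  fun_prop

theorem norm_pathH_le {z : ℂ} (hy : 0 ≤ z.im) (hs : 0 ≤ √3 * z.re + z.im) {v : ℝ} (hv : 0 < v) :
    ‖pathH z v‖ ≤ 4 + 2 * (|z.re| / z.im) := by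
  refine (norm_add_le _ _).trans ?_
  rw [Complex.norm_real, Complex.norm_I, Real.norm_eq_abs]
  linarith [abs_slope_le hy hs hv]

theorem integrableOn_exp_linear {b : ℝ} (hb : 0 < b) (C D : ℝ) :
    IntegrableOn (fun v : ℝ => D * rexp (C - b * v)) (Ioi 0) := by
  have := ((exp_neg_integrableOn_Ioi 0 hb).const_mul (D * rexp C))
  refine this.congr (ae_of_all _ fun v => ?_)
  simp only []
  rw [mul_assoc, ← Real.exp_add]
  ring_nf

theorem integrableOn_pathIntegrand {z : ℂ} (hy : 0 ≤ z.im) (hs : 0 ≤ √3 * z.re + z.im) :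
    IntegrableOn (pathIntegrand z) (Ioi 0) := by
  obtain ⟨b, C, hb, h⟩ := exists_linear_le_phiRe hy hs
  refine (integrableOn_exp_linear hb C (4 + 2 * (|z.re| / z.im))).mono'
    (measurable_pathIntegrand z).aestronglyMeasurable ?_
  filter_upwards [ae_restrict_mem measurableSet_Ioi] with v (hv : 0 < v)
  rw [pathIntegrand, norm_mul, Complex.norm_real, Real.norm_eq_abs, abs_of_pos (exp_pos _),
    mul_comm]
  gcongr
  · exact norm_pathH_le hy hs hv
  · linarith [h v hv]

/-! ### The two ends of the curve -/

theorem tendsto_pathU_div (z : ℂ) :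
    Tendsto (fun v => pathU z v / v) atTop (𝓝 (-(√3 / 3))) := by
  -- In the variable `w = 1/v` the ratio `u/v` extends continuously to `w = 0`.
  have hc : Continuous fun w : ℝ =>
      (z.im * w ^ 2 - √(z.im ^ 2 * w ^ 4 + 4 * z.re * w ^ 2 + 4 / 3)) / 2 := by fun_prop
  have h := (hc.tendsto 0).comp tendsto_inv_atTop_zero
  have h3 : √3 ^ 2 = 3 := sq_sqrt (by norm_num)
  have e : √((4 : ℝ) / 3) = 2 * √3 / 3 := by
    rw [sqrt_eq_iff_mul_self_eq (by norm_num) (by positivity)]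
    linear_combination (-4 / 9) * h3
  have e2 : (z.im * (0 : ℝ) ^ 2 - √(z.im ^ 2 * 0 ^ 4 + 4 * z.re * 0 ^ 2 + 4 / 3)) / 2
      = -(√3 / 3) := by
    norm_num [e]
    ring
  rw [e2] at h
  refine h.congr' ?_
  filter_upwards [eventually_gt_atTop 0] with v hv
  have hR : bigR z v = v ^ 2 * √(z.im ^ 2 * v⁻¹ ^ 4 + 4 * z.re * v⁻¹ ^ 2 + 4 / 3) := by
    rw [bigR, radicand]
    conv_rhs => rw [← sqrt_sq (show 0 ≤ v ^ 2 by positivity), ← sqrt_mul (by positivity)]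
    congr 1
    field_simp
    ring
  simp only [Function.comp_def, pathU]
  rw [hR]
  field_simp

theorem tendsto_norm_pathT (z : ℂ) : Tendsto (fun v => ‖pathT z v‖) atTop atTop := by
  refine tendsto_atTop_mono (fun v => ?_) tendsto_id
  have h := (le_abs_self _).trans (Complex.abs_im_le_norm (pathT z v))
  simpa [pathT] using h

theorem exp_two_pi_I_div_three :
    Complex.exp (2 * π * Complex.I / 3) = -1 / 2 + √3 / 2 * Complex.I := by
  have h : (2 * π * Complex.I / 3 : ℂ) = ((2 * π / 3 : ℝ) : ℂ) * Complex.I := by push_cast; ring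
  have e : 2 * π / 3 = π - π / 3 := by ring
  rw [h, Complex.exp_mul_I, ← Complex.ofReal_cos, ← Complex.ofReal_sin, e, cos_pi_sub,
    sin_pi_sub, cos_pi_div_three, sin_pi_div_three]
  push_cast
  ring

theorem sqrt_three_sq_complex : (√3 : ℂ) ^ 2 = 3 := by
  rw [← Complex.ofReal_pow, sq_sqrt (by norm_num)]; norm_num

theorem tendsto_pathT_div (z : ℂ) :
    Tendsto (fun v => pathT z v / (v : ℂ)) atTop
      (𝓝 (((2 / √3 : ℝ) : ℂ) * Complex.exp (2 * π * Complex.I / 3))) := by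
  have h := ((Complex.continuous_ofReal.tendsto _).comp (tendsto_pathU_div z)).add_const Complex.I
  have h3 : (√3 : ℂ) ≠ 0 := by simp
  have e : ((-(√3 / 3) : ℝ) : ℂ) + Complex.I =
      ((2 / √3 : ℝ) : ℂ) * Complex.exp (2 * π * Complex.I / 3) := by
    rw [exp_two_pi_I_div_three]
    push_cast
    field_simp
    linear_combination -sqrt_three_sq_complex
  rw [e] at h
  refine h.congr' ?_
  filter_upwards [eventually_gt_atTop 0] with v hv
  have : (v : ℂ) ≠ 0 := by exact_mod_cast hv.ne'
  simp only [Function.comp_def, pathT]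
  push_cast
  field_simp

theorem norm_exp_two_pi_I_div_three : ‖Complex.exp (2 * π * Complex.I / 3)‖ = 1 := by
  rw [show (2 * π * Complex.I / 3 : ℂ) = ((2 * π / 3 : ℝ) : ℂ) * Complex.I by push_cast; ring,
    Complex.norm_exp_ofReal_mul_I]

theorem tendsto_pathT_direction (z : ℂ) :
    Tendsto (fun v => pathT z v / (‖pathT z v‖ : ℂ)) atTop
      (𝓝 (Complex.exp (2 * π * Complex.I / 3))) := by
  have h := tendsto_pathT_div z
  have hpos : (0 : ℝ) < 2 / √3 := by positivity
  have hn := (Complex.continuous_ofReal.tendsto _).comp h.norm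
  have hl : ‖((2 / √3 : ℝ) : ℂ) * Complex.exp (2 * π * Complex.I / 3)‖ = 2 / √3 := by
    rw [norm_mul, norm_exp_two_pi_I_div_three, Complex.norm_real, mul_one, Real.norm_eq_abs,
      abs_of_pos hpos]
  rw [hl] at hn
  have hne : ((2 / √3 : ℝ) : ℂ) ≠ 0 := by exact_mod_cast hpos.ne'
  have hd := h.div hn hne
  rw [mul_div_cancel_left₀ _ hne] at hd
  refine hd.congr' ?_
  filter_upwards [eventually_gt_atTop 0] with v hv
  have hv' : (v : ℂ) ≠ 0 := by exact_mod_cast hv.ne'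
  simp only [Function.comp_def, Pi.div_apply, norm_div, Complex.norm_real, Real.norm_eq_abs,
    abs_of_pos hv]
  push_cast
  exact div_div_div_cancel_right₀ hv' _ _

theorem tendsto_pathT_zero_of_im_pos {z : ℂ} (hs : 0 ≤ √3 * z.re + z.im) (hy : 0 < z.im) :
    Tendsto (pathT z) (𝓝[>] 0) (𝓝 0) := by
  have hR := continuous_bigR z
  -- Rationalised, `u = -2v(x + v²/3)/(R + y)`, which is continuous at `0` because `R + y ≥ y > 0`.
  have hc : Continuous fun v : ℝ =>
      ((-(2 * v * (z.re + v ^ 2 / 3)) / (bigR z v + z.im) : ℝ) : ℂ) + v * Complex.I := by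
    have : ∀ v, bigR z v + z.im ≠ 0 := fun v => by linarith [bigR_nonneg z v]
    fun_prop (disch := assumption)
  have h := (hc.tendsto 0).mono_left (nhdsWithin_le_nhds (s := Ioi 0))
  simp only [mul_zero, zero_mul, neg_zero, zero_div, Complex.ofReal_zero, add_zero] at h
  refine h.congr' ?_
  filter_upwards [self_mem_nhdsWithin] with v (hv : 0 < v)
  rw [pathT]
  congr 2
  have h1 : bigR z v + z.im ≠ 0 := by linarith [bigR_nonneg z v]
  have hsq := bigR_sq hs v
  unfold radicand at hsq
  unfold pathU
  field_simp
  linear_combination 3 * hsq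

theorem tendsto_pathT_zero_of_im_eq_zero {z : ℂ} (hy : z.im = 0) :
    Tendsto (pathT z) (𝓝[>] 0) (𝓝 ((-√z.re : ℝ) : ℂ)) := by
  have hc : Continuous fun v : ℝ =>
      ((-√(z.re + v ^ 2 / 3) : ℝ) : ℂ) + v * Complex.I := by fun_prop
  have h := (hc.tendsto 0).mono_left (nhdsWithin_le_nhds (s := Ioi 0))
  norm_num at h
  push_cast
  refine h.congr' ?_
  filter_upwards [self_mem_nhdsWithin] with v (hv : 0 < v)
  have hR : bigR z v = 2 * v * √(z.re + v ^ 2 / 3) := by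
    rw [bigR, radicand, hy, ← sqrt_sq (show 0 ≤ 2 * v by positivity), ← sqrt_mul (by positivity)]
    congr 1
    ring
  rw [pathT, pathU, hR, hy]
  have : (v : ℂ) ≠ 0 := by exact_mod_cast hv.ne'
  push_cast
  field_simp
  ring

/-! ### Improper integrals and rotation of rays -/

/-- The fundamental theorem of calculus on `(a, ∞)`, with countably many exceptional points. -/
theorem integral_Ioi_of_hasDerivAt_off_countable {f f' : ℝ → ℂ} {a : ℝ} {s : Set ℝ}
    (hs : s.Countable) (hc : ContinuousOn f (Ioi a))
    (hd : ∀ x ∈ Ioi a \ s, HasDerivAt f (f' x) x) (hi : IntegrableOn f' (Ioi a)) {l m : ℂ}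
    (hl : Tendsto f (𝓝[>] a) (𝓝 l)) (hm : Tendsto f atTop (𝓝 m)) :
    ∫ x in Ioi a, f' x = m - l := by
  have h1 : ∀ x ∈ Ioi a, ∫ t in Ioi x, f' t = m - f x := by
    intro x hx
    refine tendsto_nhds_unique (intervalIntegral_tendsto_integral_Ioi x
      (hi.mono_set (Ioi_subset_Ioi (le_of_lt hx))) tendsto_id) ?_
    refine (hm.sub_const (f x)).congr' ?_
    filter_upwards [eventually_ge_atTop x] with y hy
    refine (integral_eq_of_hasDerivAt_off_countable_of_le f f' hy hs
      (hc.mono fun t ht => lt_of_lt_of_le hx ht.1)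
      (fun t ht => hd t ⟨lt_trans hx ht.1.1, ht.2⟩) ?_).symm
    rw [intervalIntegrable_iff_integrableOn_Ioc_of_le hy]
    exact hi.mono_set fun t ht => lt_trans hx ht.1
  -- `f` need not be continuous at `a`, so the lower endpoint is reached by letting `x` decrease to
  -- `a`.
  have h2 := (aecover_Ioi_of_Ioi (μ := volume) (A := a) (l := 𝓝[>] a) (a := id)
    nhdsWithin_le_nhds).integral_tendsto_of_countably_generated hi
  refine tendsto_nhds_unique h2 ((hl.const_sub m).congr' ?_)
  filter_upwards [self_mem_nhdsWithin] with x (hx : a < x)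
  rw [Measure.restrict_restrict measurableSet_Ioi, Ioi_inter_Ioi, id, max_eq_left hx.le, h1 x hx]

/-- Rotation by a cube root of unity leaves `t³` unchanged and only rotates `z`. -/
theorem rayIntegral_exp_neg_phi (z : ℂ) {θ : ℝ} (h : Complex.exp (θ * Complex.I) ^ 3 = 1) :
    rayIntegral (fun t => Complex.exp (-phi z t)) θ =
      π * Complex.exp (θ * Complex.I) * scorerHi (z * Complex.exp (θ * Complex.I)) := by
  have hpi : (π : ℂ) ≠ 0 := by exact_mod_cast pi_ne_zero
  rw [rayIntegral, integral_mul_const, scorerHi]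
  rw [show ∀ w J : ℂ, (π : ℂ) * w * (1 / π * J) = J * w by intros; field_simp]
  congr 2
  ext s
  rw [phi, mul_pow, h]
  ring_nf

/-- A cube root of `-1` turns `e^{t³/3}` into the decaying `e^{-s³/3}`, so each ray of the Airy
contour is itself a Scorer integral. -/
theorem rayIntegral_airy (z : ℂ) {θ : ℝ} (h : Complex.exp (θ * Complex.I) ^ 3 = -1) :
    rayIntegral (fun t => Complex.exp (-z * t + t ^ 3 / 3)) θ =
      π * Complex.exp (θ * Complex.I) * scorerHi (-z * Complex.exp (θ * Complex.I)) := by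
  have hpi : (π : ℂ) ≠ 0 := by exact_mod_cast pi_ne_zero
  rw [rayIntegral, integral_mul_const, scorerHi]
  rw [show ∀ w J : ℂ, (π : ℂ) * w * (1 / π * J) = J * w by intros; field_simp]
  congr 2
  ext s
  rw [mul_pow, h]
  ring_nf

theorem exp_two_pi_div_three_mul_I_pow_three :
    Complex.exp ((2 * π / 3 : ℝ) * Complex.I) ^ 3 = 1 := by
  rw [← Complex.exp_nat_mul, ← Complex.exp_two_pi_mul_I]
  push_cast; ring_nf

/-- The connection formula between `Hi` and `Ai`. -/
theorem two_mul_airyAi_eq (z : ℂ) :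
    2 * Complex.exp (-(π * Complex.I / 6)) *
        airyAi (z * Complex.exp (-(2 * π * Complex.I / 3))) =
      scorerHi z - Complex.exp (2 * π * Complex.I / 3) *
        scorerHi (z * Complex.exp (2 * π * Complex.I / 3)) := by
  have hpi : (π : ℂ) ≠ 0 := by exact_mod_cast pi_ne_zero
  have c1 : Complex.exp ((π / 3 : ℝ) * Complex.I) ^ 3 = -1 := by
    rw [← Complex.exp_nat_mul, ← Complex.exp_pi_mul_I]; push_cast; ring_nf
  have c2 : Complex.exp ((-(π / 3) : ℝ) * Complex.I) ^ 3 = -1 := by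
    rw [← Complex.exp_nat_mul, ← Complex.exp_neg_pi_mul_I]; push_cast; ring_nf
  rw [airyAi, rayIntegral_airy _ c1, rayIntegral_airy _ c2]
  -- The rays at `π/3` and `-π/3` give `Hi` at `z e^{2πi/3}` and at `z`; `k1` and `k2` below combine
  -- the prefactors.
  have w1 : -(z * Complex.exp (-(2 * π * Complex.I / 3))) * Complex.exp ((π / 3 : ℝ) * Complex.I)
      = z * Complex.exp (2 * π * Complex.I / 3) := by
    have : Complex.exp (2 * π * Complex.I / 3) = -Complex.exp (-(2 * π * Complex.I / 3)) *
        Complex.exp ((π / 3 : ℝ) * Complex.I) := by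
      rw [neg_mul, ← Complex.exp_add, neg_eq_neg_one_mul, ← Complex.exp_pi_mul_I,
        ← Complex.exp_add]
      push_cast; ring_nf
    rw [this]; ring
  have w2 : -(z * Complex.exp (-(2 * π * Complex.I / 3))) *
      Complex.exp ((-(π / 3) : ℝ) * Complex.I) = z := by
    have : Complex.exp (-(2 * π * Complex.I / 3)) * Complex.exp ((-(π / 3) : ℝ) * Complex.I)
        = -1 := by
      rw [← Complex.exp_add, ← Complex.exp_neg_pi_mul_I]
      push_cast; ring_nf
    linear_combination (-z) * this
  rw [w1, w2]
  have k1 : Complex.exp (-(π * Complex.I / 6)) * Complex.exp ((π / 3 : ℝ) * Complex.I) =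
      -Complex.I * Complex.exp (2 * π * Complex.I / 3) := by
    rw [← Complex.exp_neg_pi_div_two_mul_I, ← Complex.exp_add, ← Complex.exp_add]
    push_cast; ring_nf
  have k2 : Complex.exp (-(π * Complex.I / 6)) * Complex.exp ((-(π / 3) : ℝ) * Complex.I) =
      -Complex.I := by
    rw [← Complex.exp_neg_pi_div_two_mul_I, ← Complex.exp_add]
    push_cast; ring_nf
  have hI : Complex.I ≠ 0 := Complex.I_ne_zero
  generalize Complex.exp ((π / 3 : ℝ) * Complex.I) = A at k1 ⊢
  generalize Complex.exp ((-(π / 3) : ℝ) * Complex.I) = B at k2 ⊢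
  field_simp
  linear_combination scorerHi (z * Complex.exp (2 * π * Complex.I / 3)) * k1 - scorerHi z * k2

/-! ### Comparison of the curve with the ray -/

theorem differentiable_exp_neg_phi (z : ℂ) : Differentiable ℂ fun t => Complex.exp (-phi z t) := by
  unfold phi; fun_prop

theorem norm_exp_neg_phi (z : ℂ) (u v : ℝ) :
    ‖Complex.exp (-phi z (u + v * Complex.I))‖ = rexp (-phiRe z u v) := by
  rw [phi_eq, Complex.norm_exp]; simp

theorem exp_neg_phi_pathT {z : ℂ} (hs : 0 ≤ √3 * z.re + z.im) {v : ℝ} (hv : v ≠ 0) :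
    Complex.exp (-phi z (pathT z v)) = (rexp (-phiRe z (pathU z v) v) : ℂ) := by
  rw [pathT, phi_eq, phiIm_pathU hs hv]; simp

theorem continuous_exp_neg_phi_ray (z ω : ℂ) :
    Continuous fun s : ℝ => Complex.exp (-phi z ((s : ℂ) * ω)) * ω := by
  unfold phi; fun_prop

theorem integrableOn_ray (z : ℂ) :
    IntegrableOn (fun s : ℝ => Complex.exp (-phi z ((s : ℂ) * Complex.exp (2 * π * Complex.I / 3)))
      * Complex.exp (2 * π * Complex.I / 3)) (Ioi 0) := by
  set ω := Complex.exp (2 * π * Complex.I / 3) with hω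
  have hω3 : ω ^ 3 = 1 := by
    rw [hω, ← exp_two_pi_div_three_mul_I_pow_three]; push_cast; ring_nf
  have hω1 : ‖ω‖ = 1 := norm_exp_two_pi_I_div_three
  set b := ‖z‖ + 1
  have hb : 0 < b := by positivity
  -- The requirement is `bs - s³/3 ≤ C`. The left side is nonpositive if `s² ≥ 3b`; otherwise `s ≤
  -- 3b + 1`.
  refine (integrableOn_exp_linear one_pos (b * (3 * b + 1)) 1).mono' ?_ ?_
  · exact (continuous_exp_neg_phi_ray z ω).aestronglyMeasurable
  · filter_upwards [ae_restrict_mem measurableSet_Ioi] with s (hs : 0 < s)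
    rw [norm_mul, hω1, mul_one, one_mul, one_mul, Complex.norm_exp]
    gcongr
    have h1 : -phi z (s * ω) = ((-(s ^ 3 / 3) : ℝ) : ℂ) + (s : ℂ) * (z * ω) := by
      rw [phi, mul_pow, hω3]; push_cast; ring
    have h2 : (z * ω).re ≤ ‖z‖ := by
      refine (Complex.re_le_norm _).trans ?_
      rw [norm_mul, hω1, mul_one]
    rw [h1, Complex.add_re, Complex.ofReal_re, Complex.re_ofReal_mul]
    have h3 : s * (z * ω).re ≤ s * (b - 1) := by gcongr; linarith
    rcases le_or_gt (3 * b) (s ^ 2) with h | h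
    · have : 0 ≤ b * (3 * b + 1) := by positivity
      nlinarith [mul_le_mul_of_nonneg_left h hs.le]
    · have : s ≤ 3 * b + 1 := by nlinarith [sq_nonneg (s - 1)]
      have := mul_le_mul_of_nonneg_left this hb.le
      have : 0 ≤ s ^ 3 := by positivity
      linarith

/-- In this sector `-u(v² - u²/3) ≥ v³/3`, and the lower bound on `v²` makes this absorb both `|x|
v` and `v`. The limiting slope `u/v = -√3/3` lies strictly inside `(-1, -1/2)`, so curve and ray
both end up there. -/
theorem le_phiRe_of_mem_Icc (z : ℂ) {u v : ℝ} (hv : 0 < v) (hzv : 3 * (|z.re| + 1) ≤ v ^ 2)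
    (hy : 0 ≤ z.im) (hu : u ∈ Icc (-v) (-(v / 2))) : v ≤ phiRe z u v := by
  obtain ⟨h1, h2⟩ := hu
  have hx : -(|z.re| * v) ≤ -u * z.re := by
    have : |u * z.re| ≤ v * |z.re| := by
      rw [abs_mul]; gcongr; rw [abs_le]; constructor <;> linarith
    linarith [le_abs_self (u * z.re)]
  have hsq : u ^ 2 ≤ v ^ 2 := by nlinarith
  have h3 : v / 2 * (2 / 3 * v ^ 2) ≤ -u * (v ^ 2 - u ^ 2 / 3) := by
    gcongr
    · linarith
    · linarith
    · linarith
  have h4 := mul_le_mul_of_nonneg_left hzv hv.le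
  have h5 := mul_nonneg hy hv.le
  unfold phiRe
  nlinarith

/-- A primitive of `e^{-φ}` has the same limit along the path and along the ray `ph t = 2π/3`. -/
theorem tendsto_primitive_pathT_sub {z : ℂ} (hy : 0 ≤ z.im) {F : ℂ → ℂ}
    (hF : ∀ t, HasDerivAt F (Complex.exp (-phi z t)) t) :
    Tendsto (fun v : ℝ => F (pathT z v) -
      F (((2 / √3 * v : ℝ) : ℂ) * Complex.exp (2 * π * Complex.I / 3))) atTop (𝓝 0) := by
  have h3 : √3 ^ 2 = 3 := sq_sqrt (by norm_num)
  have h3' : 0 < √3 := by positivity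
  have hr1 : 1 / 2 < √3 / 3 := by nlinarith
  have hr2 : √3 / 3 < 1 := by nlinarith
  have h0 : Tendsto (fun v : ℝ => rexp (-v) * v) atTop (𝓝 0) := by
    simpa [mul_comm] using tendsto_pow_mul_exp_neg_atTop_nhds_zero 1
  refine squeeze_zero_norm' ?_ h0
  have e1 : ∀ᶠ v : ℝ in atTop, 3 * (|z.re| + 1) ≤ v ^ 2 :=
    (tendsto_pow_atTop two_ne_zero).eventually_ge_atTop _
  filter_upwards [eventually_gt_atTop 0, e1,
    (tendsto_pathU_div z).eventually (lt_mem_nhds (show (-1 : ℝ) < -(√3 / 3) by linarith)),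
    (tendsto_pathU_div z).eventually (gt_mem_nhds (show -(√3 / 3) < (-(1 / 2) : ℝ) by linarith))]
    with v hv hzv hu1 hu2
  rw [lt_div_iff₀ hv] at hu1
  rw [div_lt_iff₀ hv] at hu2
  -- The factor `2/√3` puts the point of the ray at height `v`, level with the point of the curve.
  have hpt : ((2 / √3 * v : ℝ) : ℂ) * Complex.exp (2 * π * Complex.I / 3) =
      ((-(√3 / 3 * v) : ℝ) : ℂ) + v * Complex.I := by
    have h3c : (√3 : ℂ) ≠ 0 := by simp
    rw [exp_two_pi_I_div_three]
    push_cast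
    field_simp
    linear_combination v * sqrt_three_sq_complex
  have ha : -(√3 / 3 * v) ∈ Icc (-v) (-(v / 2)) := by constructor <;> nlinarith
  have hb : pathU z v ∈ Icc (-v) (-(v / 2)) := by constructor <;> linarith
  have hd : ∀ u ∈ Icc (-v) (-(v / 2)), HasDerivWithinAt
      (fun u : ℝ => F ((u : ℂ) + v * Complex.I)) (Complex.exp (-phi z (u + v * Complex.I)))
      (Icc (-v) (-(v / 2))) u := fun u _ => by
    have := ((hF ((u : ℂ) + v * Complex.I)).comp_add_const (u : ℂ) (v * Complex.I)).comp_ofReal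
    exact this.hasDerivWithinAt
  have hbound := (convex_Icc (-v) (-(v / 2))).norm_image_sub_le_of_norm_hasDerivWithin_le
    (C := rexp (-v)) hd (fun u hu => by
      rw [norm_exp_neg_phi]
      exact Real.exp_le_exp.2 (neg_le_neg (le_phiRe_of_mem_Icc z hv hzv hy hu))) ha hb
  rw [hpt, pathT]
  refine hbound.trans ?_
  gcongr
  rw [Real.norm_eq_abs, abs_le]
  constructor <;> linarith [ha.1, ha.2, hb.1, hb.2]

/-- The integral along the curved part of the path, from its starting point `p`. -/
theorem integral_pathIntegrand {z : ℂ} (hy : 0 ≤ z.im) (hs : 0 ≤ √3 * z.re + z.im) {F : ℂ → ℂ}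
    (hF : ∀ t, HasDerivAt F (Complex.exp (-phi z t)) t) {p : ℂ}
    (hp : Tendsto (pathT z) (𝓝[>] 0) (𝓝 p)) :
    ∫ v in Ioi (0 : ℝ), pathIntegrand z v =
      F 0 - F p + π * Complex.exp (2 * π * Complex.I / 3) *
        scorerHi (z * Complex.exp (2 * π * Complex.I / 3)) := by
  set ω := Complex.exp (2 * π * Complex.I / 3) with hω
  have hωr : Complex.exp ((2 * π / 3 : ℝ) * Complex.I) = ω := by
    rw [hω]; push_cast; ring_nf
  have hray := rayIntegral_exp_neg_phi z exp_two_pi_div_three_mul_I_pow_three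
  rw [hωr] at hray
  have hFc : Continuous F := continuous_iff_continuousAt.2 fun t => (hF t).continuousAt
  have hlim : Tendsto (fun s : ℝ => F ((s : ℂ) * ω)) atTop
      (𝓝 (F 0 + rayIntegral (fun t => Complex.exp (-phi z t)) (2 * π / 3))) := by
    have h1 := (intervalIntegral_tendsto_integral_Ioi 0 (integrableOn_ray z)
      tendsto_id).const_add (F 0)
    rw [rayIntegral, hωr]
    refine h1.congr fun s => ?_
    rw [intervalIntegral.integral_eq_sub_of_hasDerivAt (f := fun s : ℝ => F ((s : ℂ) * ω))
      (fun x _ => ?_) ((continuous_exp_neg_phi_ray z ω).intervalIntegrable _ _)]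
    · simp
    · have := (hF ((x : ℂ) * ω)).comp (x : ℂ) ((hasDerivAt_id (x : ℂ)).mul_const ω)
      rw [one_mul] at this
      exact this.comp_ofReal
  have hscale : Tendsto (fun v : ℝ => 2 / √3 * v) atTop atTop :=
    tendsto_id.const_mul_atTop (by positivity)
  have hpath := (tendsto_primitive_pathT_sub hy hF).add (hlim.comp hscale)
  simp only [Function.comp_def, ← hω, sub_add_cancel, zero_add] at hpath
  -- The possible corner is excluded for every `z`; if `x ≥ 0` this square root is `0`, outside the
  -- domain.
  rw [integral_Ioi_of_hasDerivAt_off_countable (f := fun v => F (pathT z v))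
    (countable_singleton √(-(3 * z.re / 2))) (hFc.comp_continuousOn (continuousOn_pathT z)) ?_
    (integrableOn_pathIntegrand hy hs) ((hFc.tendsto p).comp hp) hpath, hray]
  · ring
  · rintro v ⟨hv, hv'⟩
    have hv : 0 < v := hv
    have := (hF (pathT z v)).comp v
      (hasDerivAt_pathT hs hv (radicand_pos hy hs hv fun _ => hv'))
    rwa [exp_neg_phi_pathT hs hv.ne'] at this

theorem integral_segment {z : ℂ} (hy : z.im = 0) {F : ℂ → ℂ}
    (hF : ∀ t, HasDerivAt F (Complex.exp (-phi z t)) t) (a : ℝ) :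
    ∫ u in (0 : ℝ)..a, (rexp (-phiRe z u 0) : ℂ) = F (a : ℂ) - F 0 := by
  have h : ∀ u : ℝ, (rexp (-phiRe z u 0) : ℂ) = Complex.exp (-phi z u) := fun u => by
    have := phi_eq z u 0
    simp only [Complex.ofReal_zero, zero_mul, add_zero] at this
    rw [this]
    simp [phiIm, hy]
  simp_rw [h]
  have hcont : Continuous fun u : ℝ => Complex.exp (-phi z u) :=
    (differentiable_exp_neg_phi z).continuous.comp Complex.continuous_ofReal
  rw [intervalIntegral.integral_eq_sub_of_hasDerivAt (f := fun u : ℝ => F u)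
    (fun x _ => (hF x).comp_ofReal) (hcont.intervalIntegrable _ _)]
  simp

/-- Since `Complex.arg 0 = 0`, the hypotheses include `z = 0`. -/
theorem mainTheorem6 (z : ℂ) (hz₀ : 0 ≤ z.arg) (hz₁ : z.arg ≤ 2 * π / 3) :
    -- `R` is defined for all `v`, and `𝓛` is a continuous path on which `φ_i` vanishes
    (∀ v : ℝ, 0 ≤ radicand z v) ∧
    ContinuousOn (pathT z) (Ioi 0) ∧
    (∀ v : ℝ, 0 < v → phiIm z (pathU z v) v = 0) ∧
    -- `h = dt/dv`, except at the corner of the path when `ph z = 2π/3`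
    (∀ v : ℝ, 0 < v → (z.arg = 2 * π / 3 → v ≠ √(-(3 * z.re / 2))) →
      HasDerivAt (pathT z) (pathH z v) v) ∧
    -- `𝓛` ends at `∞ e^{2πi/3}`
    Tendsto (fun v => ‖pathT z v‖) atTop atTop ∧
    Tendsto (fun v => pathT z v / (‖pathT z v‖ : ℂ)) atTop
      (𝓝 (Complex.exp (2 * π * Complex.I / 3))) ∧
    -- the integral along `𝓛` converges absolutely
    IntegrableOn (pathIntegrand z) (Ioi 0) ∧
    -- the case `y > 0`: `𝓛` starts at the origin, and the representation holds
    (0 < z.im →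
      Tendsto (pathT z) (𝓝[>] 0) (𝓝 0) ∧
      scorerHi z = 1 / π * (∫ v in Ioi (0 : ℝ), pathIntegrand z v)
        + 2 * Complex.exp (-(π * Complex.I / 6))
          * airyAi (z * Complex.exp (-(2 * π * Complex.I / 3))) ∧
      1 / π * (∫ v in Ioi (0 : ℝ), pathIntegrand z v)
        = Complex.exp (2 * π * Complex.I / 3)
          * scorerHi (z * Complex.exp (2 * π * Complex.I / 3))) ∧
    -- the case `y = 0`: `𝓛` first runs along the real axis from the origin to `-√x`
    (z.im = 0 →
      Tendsto (pathT z) (𝓝[>] 0) (𝓝 ((-√z.re : ℝ) : ℂ)) ∧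
      scorerHi z = 1 / π * ((∫ u in (0 : ℝ)..(-√z.re), (rexp (-phiRe z u 0) : ℂ))
          + ∫ v in Ioi (0 : ℝ), pathIntegrand z v)
        + 2 * Complex.exp (-(π * Complex.I / 6))
          * airyAi (z * Complex.exp (-(2 * π * Complex.I / 3))) ∧
      1 / π * ((∫ u in (0 : ℝ)..(-√z.re), (rexp (-phiRe z u 0) : ℂ))
          + ∫ v in Ioi (0 : ℝ), pathIntegrand z v)
        = Complex.exp (2 * π * Complex.I / 3)
          * scorerHi (z * Complex.exp (2 * π * Complex.I / 3))) ∧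
    -- the Airy term is the integral over the contour from `∞ e^{2πi/3}` to `+∞`
    1 / π * (rayIntegral (fun t => Complex.exp (-phi z t)) 0
        - rayIntegral (fun t => Complex.exp (-phi z t)) (2 * π / 3))
      = 2 * Complex.exp (-(π * Complex.I / 6))
        * airyAi (z * Complex.exp (-(2 * π * Complex.I / 3))) := by
  obtain ⟨hy, hs⟩ := im_nonneg_and_sector hz₀ hz₁
  have hpi : (π : ℂ) ≠ 0 := by exact_mod_cast pi_ne_zero
  obtain ⟨F, hF⟩ := (differentiable_exp_neg_phi z).isExactOn_univ
  replace hF : ∀ t, HasDerivAt F (Complex.exp (-phi z t)) t := fun t => hF t (mem_univ t)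
  refine ⟨radicand_nonneg hs, continuousOn_pathT z, fun v hv => phiIm_pathU hs hv.ne',
    fun v hv hc => hasDerivAt_pathT hs hv (radicand_pos hy hs hv hc), tendsto_norm_pathT z,
    tendsto_pathT_direction z, integrableOn_pathIntegrand hy hs, fun hy' => ?_, fun hy' => ?_, ?_⟩
  · have h0 := tendsto_pathT_zero_of_im_pos hs hy'
    have hI : 1 / π * (∫ v in Ioi (0 : ℝ), pathIntegrand z v)
        = Complex.exp (2 * π * Complex.I / 3)
          * scorerHi (z * Complex.exp (2 * π * Complex.I / 3)) := by
      rw [integral_pathIntegrand hy hs hF h0]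
      field_simp
      ring
    refine ⟨h0, ?_, hI⟩
    rw [hI, two_mul_airyAi_eq]
    ring
  · have h0 := tendsto_pathT_zero_of_im_eq_zero hy'
    have hI : 1 / π * ((∫ u in (0 : ℝ)..(-√z.re), (rexp (-phiRe z u 0) : ℂ))
          + ∫ v in Ioi (0 : ℝ), pathIntegrand z v)
        = Complex.exp (2 * π * Complex.I / 3)
          * scorerHi (z * Complex.exp (2 * π * Complex.I / 3)) := by
      -- The segment contributes `F(-√x) - F(0)`, cancelling the `F(0) - F(-√x)` of the curved part.
      rw [integral_pathIntegrand hy hs hF h0, integral_segment hy' hF]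
      field_simp
      ring
    refine ⟨h0, ?_, hI⟩
    rw [hI, two_mul_airyAi_eq]
    ring
  · have e : Complex.exp ((2 * π / 3 : ℝ) * Complex.I) = Complex.exp (2 * π * Complex.I / 3) := by
      push_cast; ring_nf
    rw [rayIntegral_exp_neg_phi z (θ := 0) (by simp),
      rayIntegral_exp_neg_phi z exp_two_pi_div_three_mul_I_pow_three, two_mul_airyAi_eq, e]
    simp only [Complex.ofReal_zero, zero_mul, Complex.exp_zero, mul_one]
    field_simp
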